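/- Let $F$ be a field of characteristic different from two. A *form* over $F$ is a non-degenerate quadratic form on a finite-dimensional $F$-vector space of positive dimension; $\langle a_1,\dots,a_m\rangle$ denotes the diagonal form with entries $a_1,\dots,a_m\in F^\times$, and $\otimes$ denotes the tensor product of forms. A form over a field is *hyperbolic* if it is isometric to an orthogonal sum of copies of $\langle 1,-1\rangle$. For $n\ge 0$, an *$n$-fold Pfister form* over $F$ is a form isometric to $\langle 1,a_1\rangle\otimes\cdots\otimes\langle 1,a_n\rangle$ for some $a_1,\dots,a_n\in F^\times$ (to $\langle 1\rangle$ if $n=0$). For a form $p$ over $F$ of dimension $m\ge 2$ that is not isometric to $\langle 1,-1\rangle$, the *function field* $F(p)$ is the quotient field of the integral domain $F[X_1,\dots,X_m]/(p(X_1,\dots,X_m))$, where $p$ is written as a homogeneous polynomial of degree two with respect to a basis; if $\dim p=1$ or $p\simeq\langle 1,-1\rangle$, one sets $F(p)=F$. A form over $F$ is said to be hyperbolic over an extension $K/F$ if it becomes hyperbolic after extension of scalars to $K$. **Corollary F32** (Fitzgerald). Let $p$, $q$ and $\pi$ be forms over $F$, with $\pi$ an $n$-fold Pfister form for some $n\ge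 0$. If $q$ is hyperbolic over $F(p)$, then $\pi\otimes q$ is hyperbolic over $F(\pi\otimes p)$. -/

import Mathlib

open scoped TensorProduct

noncomputable section

namespace PfisterMultiples

universe u v w

/-- The diagonal form `⟨1, a⟩`. -/
def binaryForm {F : Type u} [CommRing F] (a : F) : QuadraticForm F (Fin 2 → F) :=
  QuadraticMap.weightedSumSquares F ![1, a]

/-- A quadratic form over a field is hyperbolic if it is isometric to an orthogonal sum
`m × ⟨1, -1⟩` of hyperbolic planes, i.e. to the diagonal form with `m` entries `1` and
`m` entries `-1`. -/
def IsHyperbolic {K : Type u} [Field K] {V : Type v} [AddCommGroup V] [Module K V]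
    (q : QuadraticForm K V) : Prop :=
  ∃ m : ℕ, q.Equivalent (QuadraticMap.weightedSumSquares K
    (Sum.elim (fun _ => 1) (fun _ => -1) : Fin m ⊕ Fin m → K))

/-- The form `⟨1, a₁⟩ ⊗ (⟨1, a₂⟩ ⊗ (⋯ ⊗ ⟨1⟩))` attached to a list of units, together with the
vector space on which it is defined. -/
def pfisterModule {F : Type u} [Field F] [Invertible (2 : F)] :
    List Fˣ → QuadraticModuleCat.{u} F
  | [] => QuadraticModuleCat.of (QuadraticMap.sq (R := F))
  | a :: l => QuadraticModuleCat.of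
      (QuadraticForm.tmul (binaryForm (a : F)) (pfisterModule l).form)

/-- `π` is an `n`-fold Pfister form: it is isometric to `⟨1, a₁⟩ ⊗ ⋯ ⊗ ⟨1, aₙ⟩` for some
`a₁, …, aₙ ∈ Fˣ` (and to `⟨1⟩` if `n = 0`). -/
def IsPfister {F : Type u} [Field F] [Invertible (2 : F)] (n : ℕ)
    {V : Type v} [AddCommGroup V] [Module F V] (π : QuadraticForm F V) : Prop :=
  ∃ a : Fin n → Fˣ, π.Equivalent (pfisterModule (List.ofFn a)).form

/-- The homogeneous polynomial `p(X₁, …, Xₙ)` of degree two that describes the quadratic form `p`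
in the coordinates given by the basis `b`. -/
def formPolynomial {F : Type u} [Field F] [Invertible (2 : F)]
    {V : Type v} [AddCommGroup V] [Module F V] {ι : Type w} [Fintype ι]
    (p : QuadraticForm F V) (b : Module.Basis ι F V) : MvPolynomial ι F :=
  ∑ i, ∑ j, MvPolynomial.C (QuadraticMap.associated p (b i) (b j)) *
    (MvPolynomial.X i * MvPolynomial.X j)

/-- `p` has dimension one or is isometric to the hyperbolic plane `⟨1, -1⟩`: the cases in which
`F(p)` is `F` by convention. -/
def HasTrivialFunctionField {F : Type u} [Field F] {V : Type v} [AddCommGroup V] [Module F V]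
    (p : QuadraticForm F V) : Prop :=
  Module.finrank F V = 1 ∨ p.Equivalent (binaryForm (-1 : F))

/-- The extension `K / F` is (a copy of) the function field `F(p)`: it is `F` itself if
`dim p = 1` or `p ≃ ⟨1, -1⟩`, and otherwise the quotient field of
`F[X₁, …, Xₙ] / (p(X₁, …, Xₙ))`, where `p` is written as a polynomial in some coordinates. -/
def IsFunctionField {F : Type u} [Field F] [Invertible (2 : F)]
    {V : Type v} [AddCommGroup V] [Module F V] (p : QuadraticForm F V)
    (K : Type w) [Field K] [Algebra F K] : Prop :=
  (HasTrivialFunctionField p ∧ Nonempty (K ≃ₐ[F] F)) ∨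
  (¬ HasTrivialFunctionField p ∧ ∃ b : Module.Basis (Fin (Module.finrank F V)) F V,
    Nonempty (K ≃ₐ[F] FractionRing
      (MvPolynomial (Fin (Module.finrank F V)) F ⧸ Ideal.span {formPolynomial p b})))

/-- Evaluating the polynomial of `p` at a coordinate vector gives the value of `p`. -/
theorem eval_formPolynomial {F : Type u} [Field F] [Invertible (2 : F)]
    {V : Type v} [AddCommGroup V] [Module F V] {ι : Type w} [Fintype ι]
    (p : QuadraticForm F V) (b : Module.Basis ι F V) (x : ι → F) :
    MvPolynomial.eval x (formPolynomial p b) = p (∑ i, x i • b i) := by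
  have h := QuadraticMap.associated_eq_self_apply F p (∑ i, x i • b i)
  rw [← h]
  simp only [formPolynomial, map_sum, map_mul, MvPolynomial.eval_C, MvPolynomial.eval_X,
    LinearMap.sum_apply, map_smul, LinearMap.smul_apply, smul_eq_mul]
  simp only [Finset.mul_sum]
  rw [Finset.sum_comm]
  refine Finset.sum_congr rfl fun i _ => Finset.sum_congr rfl fun j _ => ?_
  simp only [QuadraticMap.coe_associatedHom]
  ring

theorem eval_of_totalDegree_le_one {F : Type u} [Field F] {ι : Type w} [Fintype ι]
    (f : MvPolynomial ι F) (hf : f.totalDegree ≤ 1) :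
    ∃ (c : F) (l : (ι → F) →ₗ[F] F), ∀ x, MvPolynomial.eval x f = c + l x := by
  have key : ∀ g : MvPolynomial ι F, g.IsHomogeneous 1 →
      ∃ l : (ι → F) →ₗ[F] F, ∀ x, MvPolynomial.eval x g = l x := by
    intro g hg
    have hg' : g ∈ MvPolynomial.homogeneousSubmodule ι F 1 := hg
    rw [MvPolynomial.homogeneousSubmodule_one_eq_span_X] at hg'
    induction hg' using Submodule.span_induction with
    | mem x h =>
      obtain ⟨i, rfl⟩ := h
      exact ⟨LinearMap.proj i, fun x => by simp⟩
    | zero => exact ⟨0, fun x => by simp⟩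
    | add a b ha hb iha ihb =>
      rw [← MvPolynomial.homogeneousSubmodule_one_eq_span_X] at ha hb
      obtain ⟨l, hl⟩ := iha ha
      obtain ⟨m, hm⟩ := ihb hb
      exact ⟨l + m, fun x => by simp [hl, hm]⟩
    | smul r a ha iha =>
      rw [← MvPolynomial.homogeneousSubmodule_one_eq_span_X] at ha
      obtain ⟨l, hl⟩ := iha ha
      exact ⟨r • l, fun x => by simp [hl]⟩
  have hs : f = MvPolynomial.C (MvPolynomial.coeff 0 f) + MvPolynomial.homogeneousComponent 1 f := by
    conv_lhs => rw [← MvPolynomial.sum_homogeneousComponent f]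
    have h2 : ∑ i ∈ Finset.range (f.totalDegree + 1), MvPolynomial.homogeneousComponent i f
        = ∑ i ∈ Finset.range 2, MvPolynomial.homogeneousComponent i f := by
      refine Finset.sum_subset (Finset.range_mono (by omega)) fun i _ hi => ?_
      exact MvPolynomial.homogeneousComponent_eq_zero _ _ (by simp at hi; omega)
    rw [h2, Finset.sum_range_succ, Finset.sum_range_one, MvPolynomial.homogeneousComponent_zero]
  obtain ⟨l, hl⟩ := key _ (MvPolynomial.homogeneousComponent_isHomogeneous 1 f)
  refine ⟨MvPolynomial.coeff 0 f, l, fun x => ?_⟩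
  conv_lhs => rw [hs]
  simp [hl]

/-- A nondegenerate form of dimension at least two that is a product of two linear forms
is a hyperbolic plane. -/
theorem equivalent_binaryForm_of_factor {F : Type u} [Field F] [Invertible (2 : F)]
    {V : Type v} [AddCommGroup V] [Module F V] [FiniteDimensional F V]
    (p : QuadraticForm F V) (hp : p.Nondegenerate) (h2 : 2 ≤ Module.finrank F V)
    (l m : V →ₗ[F] F) (h : ∀ x, p x = l x * m x) : p.Equivalent (binaryForm (-1 : F)) := by
  have two : (2 : F) ≠ 0 := Invertible.ne_zero 2
  let φ : V →ₗ[F] (Fin 2 → F) :=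
    LinearMap.pi ![(2 : F)⁻¹ • (l + m), (2 : F)⁻¹ • (l - m)]
  have e0 : ∀ x, φ x 0 = 2⁻¹ * (l x + m x) := fun x => by simp [φ, mul_add]
  have e1 : ∀ x, φ x 1 = 2⁻¹ * (l x - m x) := fun x => by simp [φ, mul_sub]
  have inj : Function.Injective φ := by
    rw [← LinearMap.ker_eq_bot, LinearMap.ker_eq_bot']
    intro x hx
    have h0 := e0 x
    have h1 := e1 x
    rw [hx] at h0 h1
    have hl : l x = 0 := by
      have : l x = 2⁻¹ * (l x + m x) + 2⁻¹ * (l x - m x) := by field_simp; ring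
      rw [this, ← h0, ← h1]; simp
    have hm : m x = 0 := by
      have : m x = 2⁻¹ * (l x + m x) - 2⁻¹ * (l x - m x) := by field_simp; ring
      rw [this, ← h0, ← h1]; simp
    have : x ∈ p.radical := by
      rw [QuadraticMap.mem_radical_iff']
      refine ⟨by simp [h, hl], fun y => ?_⟩
      simp [h, hl, hm]
    rw [hp.radical_eq_bot] at this
    simpa using this
  have fin : Module.finrank F V = Module.finrank F (Fin 2 → F) := by
    have := LinearMap.finrank_le_finrank_of_injective inj
    simp at this ⊢
    omega
  refine ⟨⟨LinearEquiv.ofInjectiveOfFinrankEq φ inj fin, fun x => ?_⟩⟩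
  change binaryForm (-1 : F) (φ x) = p x
  simp only [binaryForm, QuadraticMap.weightedSumSquares_apply, Fin.sum_univ_two, e0, e1, h]
  simp
  field_simp
  ring

/-- If `dim p ≥ 2` and `p` is not a hyperbolic plane, the polynomial of `p` is irreducible, so that
`F[X₁, …, Xₙ] / (p(X₁, …, Xₙ))` is a domain. -/
theorem irreducible_formPolynomial {F : Type u} [Field F] [Invertible (2 : F)]
    {V : Type v} [AddCommGroup V] [Module F V] [FiniteDimensional F V] [Nontrivial V]
    (p : QuadraticForm F V) (hp : p.Nondegenerate) (hd : ¬ HasTrivialFunctionField p)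
    {ι : Type w} [Fintype ι] (b : Module.Basis ι F V) : Irreducible (formPolynomial p b) := by
  have two : (2 : F) ≠ 0 := Invertible.ne_zero 2
  have hom : (formPolynomial p b).IsHomogeneous 2 := by
    refine MvPolynomial.IsHomogeneous.sum _ _ _ fun i _ => ?_
    refine MvPolynomial.IsHomogeneous.sum _ _ _ fun j _ => ?_
    exact ((MvPolynomial.isHomogeneous_X F i).mul (MvPolynomial.isHomogeneous_X F j)).C_mul _
  have repr : ∀ v, MvPolynomial.eval (b.repr v) (formPolynomial p b) = p v := fun v => by
    rw [eval_formPolynomial, b.sum_repr]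
  have ne : formPolynomial p b ≠ 0 := by
    intro h0
    have hz : ∀ v, p v = 0 := fun v => by rw [← repr, h0, map_zero]
    obtain ⟨v, hv⟩ := exists_ne (0 : V)
    apply hv
    have : v ∈ p.radical := by
      rw [QuadraticMap.mem_radical_iff']
      simp [hz]
    rw [hp.radical_eq_bot] at this
    simpa using this
  have deg := hom.totalDegree ne
  have h2 : 2 ≤ Module.finrank F V := by
    have := Module.finrank_pos (R := F) (M := V)
    have h1 : Module.finrank F V ≠ 1 := fun h => hd (Or.inl h)
    omega
  have unit : ∀ f : MvPolynomial ι F, f ≠ 0 → f.totalDegree = 0 → IsUnit f := by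
    intro f hf h0
    rw [MvPolynomial.totalDegree_eq_zero_iff_eq_C] at h0
    rw [h0] at hf ⊢
    exact (isUnit_iff_ne_zero.2 fun h => hf (by rw [h, map_zero])).map MvPolynomial.C
  refine ⟨fun hu => ?_, fun f g hfg => ?_⟩
  · have := (MvPolynomial.isUnit_iff_totalDegree_of_isReduced.1 hu).2
    omega
  · have hf : f ≠ 0 := by rintro rfl; simp [hfg] at ne
    have hg : g ≠ 0 := by rintro rfl; simp [hfg] at ne
    have hs := MvPolynomial.totalDegree_mul_of_isDomain hf hg
    rw [← hfg, deg] at hs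
    by_contra! hc
    have f0 : f.totalDegree ≠ 0 := fun h => hc.1 (unit f hf h)
    have g0 : g.totalDegree ≠ 0 := fun h => hc.2 (unit g hg h)
    obtain ⟨c, l, hl⟩ := eval_of_totalDegree_le_one f (by omega)
    obtain ⟨d, m, hm⟩ := eval_of_totalDegree_le_one g (by omega)
    have pv : ∀ v, p v = (c + l (b.equivFun v)) * (d + m (b.equivFun v)) := fun v => by
      rw [← hl, ← hm, ← map_mul, ← hfg, ← repr]; rfl
    refine hd (Or.inr (equivalent_binaryForm_of_factor p hp h2
      (l ∘ₗ b.equivFun.toLinearMap) (m ∘ₗ b.equivFun.toLinearMap) fun v => ?_))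
    have e0 := pv 0
    have e1 := pv v
    have e2 := pv (-v)
    rw [QuadraticMap.map_neg] at e2
    simp only [map_zero, map_neg, add_zero] at e0 e2
    simp only [LinearMap.comp_apply, LinearEquiv.coe_coe]
    have : 2 * p v = 2 * (l (b.equivFun v) * m (b.equivFun v)) := by linear_combination e1 + e2 - 2 * e0
    exact mul_left_cancel₀ two this

/-- Every form has a function field in the sense of `IsFunctionField`. -/
theorem exists_isFunctionField {F : Type u} [Field F] [Invertible (2 : F)]
    {V : Type v} [AddCommGroup V] [Module F V] [FiniteDimensional F V] [Nontrivial V]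
    (p : QuadraticForm F V) (hp : p.Nondegenerate) :
    ∃ (K : Type u) (_ : Field K) (_ : Algebra F K), IsFunctionField p K := by
  by_cases hd : HasTrivialFunctionField p
  · exact ⟨F, inferInstance, inferInstance, Or.inl ⟨hd, ⟨AlgEquiv.refl⟩⟩⟩
  · let b := Module.finBasis F V
    have hprime := (irreducible_formPolynomial p hp hd b).prime
    have : (Ideal.span {formPolynomial p b}).IsPrime :=
      (Ideal.span_singleton_prime hprime.ne_zero).2 hprime
    have : IsDomain (MvPolynomial (Fin (Module.finrank F V)) F ⧸
        Ideal.span {formPolynomial p b}) := Ideal.Quotient.isDomain _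
    exact ⟨FractionRing (MvPolynomial (Fin (Module.finrank F V)) F ⧸
        Ideal.span {formPolynomial p b}), inferInstance, inferInstance,
      Or.inr ⟨hd, b, ⟨AlgEquiv.refl⟩⟩⟩

end PfisterMultiples

end

open scoped TensorProduct

noncomputable section

namespace PfisterMultiples

open Module QuadraticMap

universe u₁

/-! Diagonalize `p` as `⟨β⟩` and `q` as `⟨w⟩`. Outside the trivial cases, `F(p)` contains a generic
zero of `⟨β⟩` and embeds into every extension of `F` that contains one
(`IsFunctionField.exists_isGenericZero`, `IsFunctionField.nonempty_algHom`). The hypothesis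
therefore says that `⟨w⟩` is hyperbolic over every field with a generic zero of `⟨β⟩`. It suffices
that this property survives multiplying both forms by `⟨1, a⟩` (`hasLagrangian_double`); a Pfister
form is a product of such factors.

Let `M` contain a generic zero `(x, y)` of `β ⊥ aβ`. Then `x` and `y` are each algebraically
independent. Put `b = β i₀` and write `β(x) = b x₀² + σ`, where `x₀` is the coordinate at `i₀`.
Replacing `x₀` by `√d / b` with `d = -bσ` gives a generic zero of `β`, so `⟨w⟩` is hyperbolic over
`M(√d)`. Such a form has every nonzero `u² - d` as a similarity factor
(`hasLagrangian_of_quadraticAlgebra`), and `u = b x₀` gives `u² - d = b β(x)`. Likewise for `b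
β(y)`. Since `β(x) = -a β(y)`, also `-a` is a similarity factor of `⟨w⟩` over `M`, that is, `⟨1, a⟩
⊗ ⟨w⟩` is hyperbolic (`hasLagrangian_of_similarity`).

Hyperbolicity is handled through large totally isotropic subspaces: `HasLagrangian.of_prod` replaces
computation in the Witt group, and `isHyperbolic_of_hasLagrangian` translates back for nondegenerate
forms. -/

/-- A quadratic form is metabolic here if it has a totally isotropic subspace of at least half
the dimension. -/
def HasLagrangian {K V : Type*} [Field K] [AddCommGroup V] [Module K V]
    (Q : QuadraticForm K V) : Prop :=
  ∃ S : Submodule K V, (∀ s ∈ S, Q s = 0) ∧ finrank K V ≤ 2 * finrank K S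

/-! ### Metabolic forms under isometry and scalar extension. -/

section Lagrangian

variable {K V V' : Type*} [Field K] [AddCommGroup V] [Module K V] [AddCommGroup V'] [Module K V']

theorem HasLagrangian.of_equivalent {Q : QuadraticForm K V} {Q' : QuadraticForm K V'}
    (h : HasLagrangian Q) (e : Q.Equivalent Q') : HasLagrangian Q' := by
  obtain ⟨S, hS, hd⟩ := h
  obtain ⟨e⟩ := e
  refine ⟨S.map e.toLinearEquiv.toLinearMap, ?_, ?_⟩
  · rintro _ ⟨s, hs, rfl⟩
    exact (e.map_app s).trans (hS s hs)
  · rw [← e.toLinearEquiv.finrank_eq, LinearEquiv.finrank_map_eq]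
    exact hd

theorem HasLagrangian.baseChange [Invertible (2 : K)] [FiniteDimensional K V]
    {Q : QuadraticForm K V} (h : HasLagrangian Q)
    (M : Type*) [Field M] [Algebra K M] : HasLagrangian (Q.baseChange M) := by
  obtain ⟨S, hS, hd⟩ := h
  have hz : (Q.baseChange M).comp (S.subtype.baseChange M) = 0 := by
    have : Invertible (2 : M) := (Invertible.map (algebraMap K M) 2).copy 2 (map_ofNat _ _).symm
    refine _root_.baseChange_ext fun s => ?_
    simp [hS s s.2]
  refine ⟨LinearMap.range (S.subtype.baseChange M), ?_, ?_⟩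
  · rintro _ ⟨s, rfl⟩
    exact DFunLike.congr_fun hz s
  · rw [LinearMap.finrank_range_of_inj, finrank_baseChange, finrank_baseChange]
    · exact hd
    · exact Module.Flat.lTensor_preserves_injective_linearMap (M := M) S.subtype S.injective_subtype

end Lagrangian

/-! ### Diagonal forms under base change and tensor product. -/

section Equivalence

theorem equivalent_weightedSumSquares_reindex {F : Type*} [Field F]
    {ι κ : Type*} [Fintype ι] [Fintype κ] (e : ι ≃ κ)
    (w : κ → F) : (weightedSumSquares F (w ∘ e)).Equivalent (weightedSumSquares F w) := by
  refine ⟨⟨LinearEquiv.funCongrLeft F F e.symm, fun m => ?_⟩⟩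
  change weightedSumSquares F w (m ∘ e.symm) = weightedSumSquares F (w ∘ e) m
  simp only [weightedSumSquares_apply]
  exact (Fintype.sum_equiv e _ _ fun i => by simp).symm

variable {F : Type*} [Field F] [Invertible (2 : F)]
variable {V V' W W' : Type*} [AddCommGroup V] [Module F V] [AddCommGroup V'] [Module F V']
variable [AddCommGroup W] [Module F W] [AddCommGroup W'] [Module F W']

theorem equivalent_baseChange {Q : QuadraticForm F V} {Q' : QuadraticForm F V'}
    (h : Q.Equivalent Q') (M : Type*) [Field M] [Algebra F M] :
    (Q.baseChange M).Equivalent (Q'.baseChange M) := by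
  obtain ⟨e⟩ := h
  refine ⟨⟨e.toLinearEquiv.baseChange F M, fun m => ?_⟩⟩
  have : Invertible (2 : M) := (Invertible.map (algebraMap F M) 2).copy 2 (map_ofNat _ _).symm
  have : (Q'.baseChange M).comp (e.toLinearEquiv.baseChange F M).toLinearMap = Q.baseChange M :=
    _root_.baseChange_ext fun s => by simp
  exact DFunLike.congr_fun this m

theorem equivalent_tmul {Q : QuadraticForm F V} {Q' : QuadraticForm F V'}
    {R : QuadraticForm F W} {R' : QuadraticForm F W'}
    (h : Q.Equivalent Q') (h' : R.Equivalent R') : (Q.tmul R).Equivalent (Q'.tmul R') := by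
  obtain ⟨e⟩ := h
  obtain ⟨f⟩ := h'
  exact ⟨⟨TensorProduct.congr e.toLinearEquiv f.toLinearEquiv,
    QuadraticForm.tmul_tensorMap_apply e.toIsometry f.toIsometry⟩⟩

theorem equivalent_weightedSumSquares_of_basis {ι : Type*} [Fintype ι] [DecidableEq ι]
    (Q : QuadraticForm F V) (b : Basis ι F V) (w : ι → F)
    (h : ∀ i j, associated Q (b i) (b j) = if i = j then w i else 0) :
    Q.Equivalent (weightedSumSquares F w) := by
  have : w = fun i => Q (b i) := by
    ext i
    rw [← associated_eq_self_apply F Q]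
    simp [h]
  rw [this, ← basisRepr_eq_of_iIsOrtho Q b]
  · exact ⟨isometryEquivBasisRepr Q b⟩
  · intro i j hij
    exact (h i j).trans (if_neg hij)

theorem associated_weightedSumSquares {ι : Type*} [Fintype ι] (w x y : ι → F) :
    associated (weightedSumSquares F w) x y = ∑ i, w i * (x i * y i) := by
  simp only [associated_apply, weightedSumSquares_apply, Pi.add_apply, smul_eq_mul,
    ← Finset.sum_sub_distrib]
  rw [Module.End.smul_def, half_moduleEnd_apply_eq_half_smul, smul_eq_mul, Finset.mul_sum]
  refine Finset.sum_congr rfl fun i _ => ?_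
  have : (⅟2 : F) * 2 = 1 := invOf_mul_self _
  linear_combination (w i * (x i * y i)) * this

theorem associated_weightedSumSquares_basisFun {ι : Type*} [Fintype ι] [DecidableEq ι]
    (w : ι → F) (i j : ι) :
    associated (weightedSumSquares F w) (Pi.basisFun F ι i) (Pi.basisFun F ι j) =
      if i = j then w i else 0 := by
  rw [associated_weightedSumSquares, Finset.sum_eq_single i]
  · simp [Pi.single_apply]
  · intro k _ hk
    simp [hk]
  · simp

theorem baseChange_weightedSumSquares {ι : Type*} [Fintype ι] (w : ι → F)
    (M : Type*) [Field M] [Algebra F M] :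
    (QuadraticForm.baseChange M (weightedSumSquares F w)).Equivalent
      (weightedSumSquares M fun i => algebraMap F M (w i)) := by
  classical
  have : Invertible (2 : M) := (Invertible.map (algebraMap F M) 2).copy 2 (map_ofNat _ _).symm
  refine equivalent_weightedSumSquares_of_basis _ ((Pi.basisFun F ι).baseChange M) _ fun i j => ?_
  rw [QuadraticForm.associated_baseChange]
  simp only [Basis.baseChange_apply, LinearMap.BilinForm.baseChange_tmul,
    associated_weightedSumSquares_basisFun]
  split_ifs <;> simp [Algebra.algebraMap_eq_smul_one]

theorem tmul_weightedSumSquares {ι κ : Type*} [Fintype ι] [Fintype κ] (v : ι → F) (w : κ → F) :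
    (QuadraticForm.tmul (weightedSumSquares F v) (weightedSumSquares F w)).Equivalent
      (weightedSumSquares F fun i : ι × κ => v i.1 * w i.2) := by
  classical
  refine equivalent_weightedSumSquares_of_basis _
    ((Pi.basisFun F ι).tensorProduct (Pi.basisFun F κ)) _ fun i j => ?_
  rw [QuadraticForm.associated_tmul]
  simp only [Basis.tensorProduct_apply', LinearMap.BilinForm.tmul,
    LinearMap.BilinForm.tensorDistrib_tmul, associated_weightedSumSquares_basisFun, Prod.ext_iff]
  split_ifs <;> simp_all [mul_comm]

theorem tmul_binaryForm {ι : Type*} [Fintype ι] (a : F) (w : ι → F) :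
    (QuadraticForm.tmul (binaryForm a) (weightedSumSquares F w)).Equivalent
      (weightedSumSquares F (Sum.elim w (fun i => a * w i))) := by
  refine (tmul_weightedSumSquares ![1, a] w).trans ?_
  let e : Fin 2 × ι ≃ ι ⊕ ι :=
    (Equiv.prodCongr finTwoEquiv (Equiv.refl ι)).trans (Equiv.boolProdEquivSum ι)
  refine Equivalent.trans ?_ (equivalent_weightedSumSquares_reindex e _)
  have : (fun i : Fin 2 × ι => (![1, a] : Fin 2 → F) i.1 * w i.2) =
      Sum.elim w (fun i => a * w i) ∘ e := by
    ext ⟨i, j⟩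
    fin_cases i <;> simp [e, finTwoEquiv]
  rw [this]
  exact Equivalent.refl _

end Equivalence

/-! ### Totally isotropic subspaces and Witt cancellation. -/

section Isotropic

variable {K V V' : Type*} [Field K] [Invertible (2 : K)] [AddCommGroup V] [Module K V]
  [AddCommGroup V'] [Module K V']

theorem le_orthogonal_of_isotropic {Q : QuadraticForm K V} {S : Submodule K V}
    (hS : ∀ s ∈ S, Q s = 0) : S ≤ LinearMap.BilinForm.orthogonal (associated Q) S := by
  intro s hs
  rw [LinearMap.BilinForm.mem_orthogonal_iff]
  intro t ht
  change associated Q t s = 0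
  rw [associated_apply, hS _ (S.add_mem ht hs), hS _ ht, hS _ hs]
  simp

theorem nondegenerate_prod {Q : QuadraticForm K V} {Q' : QuadraticForm K V'}
    (h : Q.Nondegenerate) (h' : Q'.Nondegenerate) : (Q.prod Q').Nondegenerate := by
  rw [nondegenerate_iff_radical_eq_bot, radical_eq_ker_associated] at h h' ⊢
  rw [Submodule.eq_bot_iff]
  rintro ⟨x, y⟩ hx
  have e1 : x ∈ LinearMap.ker (associated Q) := by
    ext z
    simpa [associated_apply] using LinearMap.congr_fun hx (z, 0)
  have e2 : y ∈ LinearMap.ker (associated Q') := by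
    ext z
    simpa [associated_apply] using LinearMap.congr_fun hx (0, z)
  rw [h] at e1
  rw [h'] at e2
  exact Prod.ext e1 e2

theorem nondegenerate_associated {Q : QuadraticForm K V} (h : Q.Nondegenerate) :
    LinearMap.BilinForm.Nondegenerate (associated Q) :=
  nondegenerate_associated_iff.2 h

variable [FiniteDimensional K V] [FiniteDimensional K V']

/-- `S` lies in its orthogonal complement, whose dimension is `dim V - dim S`. -/
theorem two_mul_finrank_le_of_isotropic {Q : QuadraticForm K V} (hQ : Q.Nondegenerate)
    {S : Submodule K V} (hS : ∀ s ∈ S, Q s = 0) : 2 * finrank K S ≤ finrank K V := by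
  have h1 := Submodule.finrank_mono (le_orthogonal_of_isotropic hS)
  rw [LinearMap.BilinForm.finrank_orthogonal (nondegenerate_associated hQ)] at h1
  have := S.finrank_le
  omega

theorem orthogonal_eq_of_isotropic {Q : QuadraticForm K V} (hQ : Q.Nondegenerate)
    {S : Submodule K V} (hS : ∀ s ∈ S, Q s = 0) (hd : finrank K V ≤ 2 * finrank K S) :
    LinearMap.BilinForm.orthogonal (associated Q) S = S := by
  symm
  refine Submodule.eq_of_le_of_finrank_le (le_orthogonal_of_isotropic hS) ?_
  rw [LinearMap.BilinForm.finrank_orthogonal (nondegenerate_associated hQ)]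
  omega

/-- Witt cancellation of metabolic forms. -/
theorem HasLagrangian.of_prod {Q : QuadraticForm K V} {Q' : QuadraticForm K V'}
    (hQ : Q.Nondegenerate) (hQ' : Q'.Nondegenerate)
    (h : HasLagrangian (Q.prod Q')) (h' : HasLagrangian Q') : HasLagrangian Q := by
  obtain ⟨N, hN, hd⟩ := h
  obtain ⟨I, hI, hd'⟩ := h'
  have hP := nondegenerate_prod hQ hQ'
  -- Since `N` and `I` are their own orthogonal complements, `O = X^⊥` lies in `N ∩ (V × I)`. As
  -- `Q'` vanishes on `I`, the projection of `O` to `V` is totally isotropic for `Q`.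
  set X : Submodule K (V × V') := N ⊔ I.map (LinearMap.inr K V V') with hX
  set O := LinearMap.BilinForm.orthogonal (associated (Q.prod Q')) X with hO
  have hON : O ≤ N := by
    rw [← orthogonal_eq_of_isotropic hP hN hd]
    exact LinearMap.BilinForm.orthogonal_le le_sup_left
  have hOI : ∀ z ∈ O, z.2 ∈ I := by
    intro z hz
    rw [← orthogonal_eq_of_isotropic hQ' hI hd', LinearMap.BilinForm.mem_orthogonal_iff]
    intro n hn
    have := LinearMap.BilinForm.mem_orthogonal_iff.1 hz (0, n)
      (Submodule.mem_sup_right ⟨n, hn, rfl⟩)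
    change associated Q' n z.2 = 0
    change associated (Q.prod Q') (0, n) z = 0 at this
    simpa [associated_apply] using this
  refine ⟨O.map (LinearMap.fst K V V'), ?_, ?_⟩
  · rintro _ ⟨z, hz, rfl⟩
    have h1 := hN z (hON hz)
    rw [prod_apply, hI _ (hOI z hz), add_zero] at h1
    exact h1
  · have hfin : finrank K O = _ :=
      LinearMap.BilinForm.finrank_orthogonal (nondegenerate_associated hP) X
    have hXX := Submodule.finrank_sup_add_finrank_inf_eq N (I.map (LinearMap.inr K V V'))
    have hI' : finrank K (I.map (LinearMap.inr K V V')) = finrank K I :=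
      (Submodule.equivMapOfInjective _ LinearMap.inr_injective I).finrank_eq.symm
    have hker := LinearMap.finrank_range_add_finrank_ker ((LinearMap.fst K V V').domRestrict O)
    rw [LinearMap.range_domRestrict] at hker
    -- The kernel of the projection sits in `N ∩ (0 × I)`, whose dimension is exactly the correction
    -- term in `dim X`, so the two cancel in the final count.
    have hk : finrank K (LinearMap.ker ((LinearMap.fst K V V').domRestrict O)) ≤
        finrank K (N ⊓ I.map (LinearMap.inr K V V') : Submodule K (V × V')) := by
      rw [(Submodule.equivMapOfInjective O.subtype O.injective_subtype _).finrank_eq]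
      apply Submodule.finrank_mono
      rintro _ ⟨⟨z, hz⟩, hz0, rfl⟩
      refine ⟨hON hz, z.2, hOI z hz, ?_⟩
      have : z.1 = 0 := hz0
      ext <;> simp [this]
    have a1 := two_mul_finrank_le_of_isotropic hP hN
    have a2 := two_mul_finrank_le_of_isotropic hQ' hI
    have hp : finrank K (V × V') = finrank K V + finrank K V' := finrank_prod
    have hXr : finrank K X = finrank K (N ⊔ I.map (LinearMap.inr K V V') :
      Submodule K (V × V')) := rfl
    omega

end Isotropic

/-! ### Orthogonal sums, and hyperbolic planes from a Lagrangian. -/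

theorem HasLagrangian.prod {K V V' : Type*} [Field K] [AddCommGroup V] [Module K V]
    [AddCommGroup V'] [Module K V'] [FiniteDimensional K V] [FiniteDimensional K V']
    {Q : QuadraticForm K V} {Q' : QuadraticForm K V'}
    (h : HasLagrangian Q) (h' : HasLagrangian Q') : HasLagrangian (Q.prod Q') := by
  obtain ⟨S, hS, hd⟩ := h
  obtain ⟨S', hS', hd'⟩ := h'
  refine ⟨LinearMap.range (S.subtype.prodMap S'.subtype), ?_, ?_⟩
  · rintro _ ⟨s, rfl⟩
    simp [hS _ s.1.2, hS' _ s.2.2]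
  · rw [finrank_prod, LinearMap.finrank_range_of_inj, finrank_prod]
    · omega
    · exact Function.Injective.prodMap S.injective_subtype S'.injective_subtype

theorem nondegenerate_weightedSumSquares {K ι : Type*} [Field K] [Invertible (2 : K)] [Fintype ι]
    {w : ι → K} (hw : ∀ i, w i ≠ 0) : (weightedSumSquares K w).Nondegenerate := by
  classical
  rw [nondegenerate_iff_radical_eq_bot, radical_eq_ker_associated, Submodule.eq_bot_iff]
  intro x hx
  ext i
  have := LinearMap.congr_fun hx (Pi.single i 1)
  rw [associated_weightedSumSquares, Finset.sum_eq_single i (by simp_all) (by simp)] at this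
  simpa [hw i] using this

/-- Nondegeneracy provides vectors dual to a basis of the Lagrangian; a correction inside the
Lagrangian makes them span a totally isotropic space too, and the resulting pairs span hyperbolic
planes. -/
theorem isHyperbolic_of_hasLagrangian {K V : Type*} [Field K] [Invertible (2 : K)]
    [AddCommGroup V] [Module K V] [FiniteDimensional K V] {Q : QuadraticForm K V}
    (hQ : Q.Nondegenerate) (h : HasLagrangian Q) : IsHyperbolic Q := by
  obtain ⟨S, hS, hd⟩ := h
  have hB := nondegenerate_associated hQ
  set B : LinearMap.BilinForm K V := associated Q with hBdef
  have hsymm : ∀ x y, B x y = B y x := fun x y => associated_isSymm K Q x y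
  have hBQ : ∀ x, B x x = Q x := associated_eq_self_apply K Q
  have hSS : ∀ s ∈ S, ∀ t ∈ S, B s t = 0 := fun s hs t ht =>
    LinearMap.BilinForm.mem_orthogonal_iff.1 (le_orthogonal_of_isotropic hS ht) s hs
  set r := finrank K S
  let e : Basis (Fin r) K S := finBasis K S
  have hsurj : ∀ φ : Dual K S, ∃ v : V, ∀ s : S, B v s = φ s := by
    intro φ
    obtain ⟨ψ, hψ⟩ := LinearMap.dualMap_surjective_of_injective S.injective_subtype φ
    obtain ⟨v, hv⟩ := (B.toDual hB).surjective ψ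
    refine ⟨v, fun s => ?_⟩
    rw [← LinearMap.BilinForm.toDual_def hB, hv, ← hψ]
    rfl
  choose f hf using fun j => hsurj (e.coord j)
  -- Subtracting half of the Gram matrix of `f` along `e` kills all `B (g i) (g j)` and leaves the
  -- pairing with `e` unchanged.
  let g : Fin r → V := fun j => f j - (⅟2 : K) • ∑ k, B (f j) (f k) • (e k : V)
  have hmem : ∀ c : Fin r → K, ∑ k, c k • (e k : V) ∈ S := fun c =>
    S.sum_mem fun k _ => S.smul_mem _ (e k).2
  have hge : ∀ i j, B (g j) (e i) = if i = j then 1 else 0 := by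
    intro i j
    have := hSS _ (hmem fun k => B (f j) (f k)) _ (e i).2
    simp only [g, map_sub, LinearMap.sub_apply, map_smul, LinearMap.smul_apply, this, hf]
    simp [Finsupp.single_apply]
  have hfe : ∀ j (c : Fin r → K), B (f j) (∑ k, c k • (e k : V)) = c j := by
    intro j c
    simp [hf, Finsupp.single_apply]
  have hgg : ∀ i j, B (g i) (g j) = 0 := by
    intro i j
    have h2 : (⅟2 : K) + ⅟2 = 1 := invOf_two_add_invOf_two
    simp only [g, map_sub, LinearMap.sub_apply, map_smul, LinearMap.smul_apply, smul_eq_mul]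
    rw [hfe, hsymm (∑ k, _ • (e k : V)) (f j), hfe, hSS _ (hmem _) _ (hmem _), hsymm (f j)]
    linear_combination (-B (f i) (f j)) * h2
  let pr : Fin r ⊕ Fin r → (Fin r ⊕ Fin r → K) →ₗ[K] K := LinearMap.proj
  -- On a hyperbolic pair, `Q (s e + t g) = 2 s t`; taking `s = x + y` and `t = (x - y) / 2` gives
  -- `x² - y²`.
  let L : (Fin r ⊕ Fin r → K) →ₗ[K] V :=
    ∑ i, LinearMap.smulRight (pr (Sum.inl i) + pr (Sum.inr i)) (e i : V) +
    ∑ i, LinearMap.smulRight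
      ((⅟2 : K) • (pr (Sum.inl i) - pr (Sum.inr i))) (g i)
  have hL : ∀ x, Q (L x) = weightedSumSquares K
      (Sum.elim (fun _ => 1) (fun _ => -1) : Fin r ⊕ Fin r → K) x := by
    intro x
    have hLx : L x = ∑ i, (x (Sum.inl i) + x (Sum.inr i)) • (e i : V) +
        ∑ i, ((⅟2 : K) * (x (Sum.inl i) - x (Sum.inr i))) • g i := by
      simp [L, pr]
    have hge_sum : ∀ c d : Fin r → K, B (∑ k, c k • g k) (∑ k, d k • (e k : V)) = ∑ k, c k * d k := by
      intro c d
      simp [hge, mul_comm]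
    have hgg' : ∀ c : Fin r → K, B (∑ k, c k • g k) (∑ k, c k • g k) = 0 := by
      intro c
      simp [hgg]
    rw [hLx, ← hBQ, map_add, map_add, LinearMap.add_apply, LinearMap.add_apply, hgg',
      hSS _ (hmem _) _ (hmem _), hsymm (∑ i, _ • (e i : V)), hge_sum, weightedSumSquares_apply,
      Fintype.sum_sum_type, zero_add, add_zero, ← Finset.sum_add_distrib, ← Finset.sum_add_distrib]
    refine Finset.sum_congr rfl fun i _ => ?_
    have h2 : (⅟2 : K) * 2 = 1 := invOf_mul_self _
    simp only [Sum.elim_inl, Sum.elim_inr, smul_eq_mul]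
    linear_combination (x (Sum.inl i) ^ 2 - x (Sum.inr i) ^ 2) * h2
  have hinj : Function.Injective L := by
    have hnd := nondegenerate_weightedSumSquares (K := K)
      (w := (Sum.elim (fun _ => 1) (fun _ => -1) : Fin r ⊕ Fin r → K)) (by rintro (i | i) <;> simp)
    rw [← LinearMap.ker_eq_bot, LinearMap.ker_eq_bot']
    intro x hx
    have : x ∈ (weightedSumSquares K
        (Sum.elim (fun _ => 1) (fun _ => -1) : Fin r ⊕ Fin r → K)).radical := by
      rw [mem_radical_iff']
      refine ⟨by rw [← hL, hx, QuadraticMap.map_zero], fun y => ?_⟩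
      rw [← hL, ← hL, map_add, hx, zero_add]
    rw [hnd.radical_eq_bot] at this
    simpa using this
  have hfin : finrank K (Fin r ⊕ Fin r → K) = finrank K V := by
    have h1 := LinearMap.finrank_le_finrank_of_injective hinj
    simp only [finrank_fintype_fun_eq_card, Fintype.card_sum, Fintype.card_fin] at h1 ⊢
    omega
  exact ⟨r, Equivalent.symm ⟨⟨LinearEquiv.ofInjectiveOfFinrankEq L hinj hfin, hL⟩⟩⟩

/-! ### Metabolic diagonal forms and similarity factors. -/

section Weighted

variable {K ι κ : Type*} [Field K] [Fintype ι] [Fintype κ]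

theorem weightedSumSquares_sumElim (w : ι → K) (w' : κ → K) :
    (weightedSumSquares K (Sum.elim w w')).Equivalent
      ((weightedSumSquares K w).prod (weightedSumSquares K w')) :=
  ⟨⟨LinearEquiv.sumArrowLequivProdArrow ι κ K K, fun m => by
    simp [Fintype.sum_sum_type, weightedSumSquares_apply]⟩⟩

/-- The Lagrangian is the diagonal `{(s, s)}`. -/
theorem hasLagrangian_hyperbolic (w : ι → K) :
    HasLagrangian (weightedSumSquares K (Sum.elim w fun i => -w i)) := by
  let L : (ι → K) →ₗ[K] (ι ⊕ ι → K) := LinearMap.funLeft K K (Sum.elim id id)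
  refine ⟨LinearMap.range L, ?_, ?_⟩
  · rintro _ ⟨s, rfl⟩
    simp [L, LinearMap.funLeft_apply, Fintype.sum_sum_type]
  · rw [LinearMap.finrank_range_of_inj]
    · simp [two_mul]
    · exact LinearMap.funLeft_injective_of_surjective _ _ _ fun i => ⟨Sum.inl i, rfl⟩

theorem IsHyperbolic.hasLagrangian {V : Type*} [AddCommGroup V] [Module K V]
    {Q : QuadraticForm K V} (h : IsHyperbolic Q) : HasLagrangian Q := by
  obtain ⟨m, h⟩ := h
  exact (hasLagrangian_hyperbolic fun _ : Fin m => (1 : K)).of_equivalent h.symm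

theorem HasLagrangian.smul_weights {w : ι → K} (h : HasLagrangian (weightedSumSquares K w))
    (c : K) : HasLagrangian (weightedSumSquares K fun i => c * w i) := by
  obtain ⟨S, hS, hd⟩ := h
  refine ⟨S, fun s hs => ?_, hd⟩
  have := hS s hs
  simp only [weightedSumSquares_apply, smul_eq_mul, mul_assoc, ← Finset.mul_sum] at this ⊢
  rw [this, mul_zero]

theorem HasLagrangian.sumElim {w : ι → K} {w' : κ → K}
    (h : HasLagrangian (weightedSumSquares K w)) (h' : HasLagrangian (weightedSumSquares K w')) :
    HasLagrangian (weightedSumSquares K (Sum.elim w w')) :=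
  (h.prod h').of_equivalent (weightedSumSquares_sumElim w w').symm

theorem HasLagrangian.of_sumElim [Invertible (2 : K)] {w : ι → K} {w' : κ → K}
    (hw : ∀ i, w i ≠ 0) (hw' : ∀ i, w' i ≠ 0)
    (h : HasLagrangian (weightedSumSquares K (Sum.elim w w')))
    (h₂ : HasLagrangian (weightedSumSquares K w')) : HasLagrangian (weightedSumSquares K w) :=
  (h.of_equivalent (weightedSumSquares_sumElim w w')).of_prod
    (nondegenerate_weightedSumSquares hw) (nondegenerate_weightedSumSquares hw') h₂

/-- In the Witt group, `⟨1, -c⟩ q = 0` and `⟨1, -c'⟩ q = 0` with `c = -a c'` give `⟨1, a⟩ q = 0`. -/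
theorem hasLagrangian_of_similarity [Invertible (2 : K)] {w : ι → K} {a c c' : K}
    (hw : ∀ i, w i ≠ 0) (ha : a ≠ 0) (hc' : c' ≠ 0) (hcc : c = -(a * c'))
    (h : HasLagrangian (weightedSumSquares K (Sum.elim w fun i => -c * w i)))
    (h' : HasLagrangian (weightedSumSquares K (Sum.elim w fun i => -c' * w i))) :
    HasLagrangian (weightedSumSquares K (Sum.elim w fun i => a * w i)) := by
  -- The form to cancel is `-a (w ⊥ -c' w) = -a w ⊥ -c w`. Added to `w ⊥ a w`, it gives `(w ⊥ -c w)
  -- ⊥ (a w ⊥ -a w)`: the form in `h` plus a hyperbolic form. The permutation `e` matches these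
  -- blocks.
  have h1 := h'.smul_weights (-a)
  refine HasLagrangian.of_sumElim (w' := fun i => -a * (Sum.elim w fun i => -c' * w i) i)
    ?_ ?_ ?_ h1
  · rintro (i | i) <;> simp [hw, ha]
  · rintro (i | i) <;> simp [hw, ha, hc']
  · have h2 := h.sumElim (hasLagrangian_hyperbolic fun i => a * w i)
    refine h2.of_equivalent ?_
    let e : (ι ⊕ ι) ⊕ (ι ⊕ ι) ≃ (ι ⊕ ι) ⊕ (ι ⊕ ι) :=
      { toFun := Sum.elim (Sum.elim (Sum.inl ∘ Sum.inl) (Sum.inr ∘ Sum.inr))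
          (Sum.elim (Sum.inl ∘ Sum.inr) (Sum.inr ∘ Sum.inl))
        invFun := Sum.elim (Sum.elim (Sum.inl ∘ Sum.inl) (Sum.inr ∘ Sum.inl))
          (Sum.elim (Sum.inr ∘ Sum.inr) (Sum.inl ∘ Sum.inr))
        left_inv := by rintro ((i | i) | (i | i)) <;> rfl
        right_inv := by rintro ((i | i) | (i | i)) <;> rfl }
    have he : Sum.elim (Sum.elim w fun i => -c * w i)
        (Sum.elim (fun i => a * w i) fun i => -(a * w i)) =
        Sum.elim (Sum.elim w fun i => a * w i)
          (fun i => -a * Sum.elim w (fun i => -c' * w i) i) ∘ e := by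
      ext i
      rcases i with ((i | i) | (i | i)) <;> simp [e, hcc]
      ring
    rw [he]
    exact equivalent_weightedSumSquares_reindex e _

/-- If `q` becomes metabolic over `M(√d)`, then elements `u² - d` are similarity factors of `q`,
up to metabolic forms. -/
theorem hasLagrangian_of_quadraticAlgebra {M : Type*} [Field M] (d : M)
    [Fact (∀ r : M, r ^ 2 ≠ d + 0 * r)] (w : ι → M) (u : M)
    (h : HasLagrangian (weightedSumSquares (QuadraticAlgebra M d 0)
      fun i => algebraMap M (QuadraticAlgebra M d 0) (w i))) :
    HasLagrangian (weightedSumSquares M (Sum.elim w fun i => -(u ^ 2 - d) * w i)) := by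
  obtain ⟨S, hS, hd⟩ := h
  -- For `s = r + t√d`, the new form takes at `(r + u t, t)` the value `w(r) + d w(t)` plus `u`
  -- times the `√d`-part of `w(s)`. Both vanish when `w(s) = 0`.
  let T : (ι → QuadraticAlgebra M d 0) →ₗ[M] (ι ⊕ ι → M) :=
    { toFun := fun s => Sum.elim (fun i => (s i).re + u * (s i).im) (fun i => (s i).im)
      map_add' := fun s t => by
        ext (i | i)
        · simp; ring
        · simp
      map_smul' := fun c s => by
        ext (i | i)
        · simp; ring
        · simp }
  have hT : Function.Injective T := by
    rw [← LinearMap.ker_eq_bot, LinearMap.ker_eq_bot']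
    intro s hs
    have h2 : ∀ i, (s i).im = 0 := fun i => congrFun hs (Sum.inr i)
    have h1 : ∀ i, (s i).re = 0 := fun i => by
      have : (s i).re + u * (s i).im = 0 := congrFun hs (Sum.inl i)
      simpa [h2] using this
    ext i <;> simp [h1, h2]
  refine ⟨(S.restrictScalars M).map T, ?_, ?_⟩
  · rintro _ ⟨s, hs, rfl⟩
    have h0 : weightedSumSquares _ _ s = 0 := hS s hs
    rw [weightedSumSquares_apply] at h0
    have hre : ∑ i, w i * ((s i).re ^ 2 + d * (s i).im ^ 2) = 0 := by
      have := congrArg (QuadraticAlgebra.linearEquivTuple d 0 · 0) h0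
      simp only [map_sum, Finset.sum_apply, QuadraticAlgebra.linearEquivTuple_apply] at this
      simpa [pow_two, mul_assoc] using this
    have him : ∑ i, w i * (2 * (s i).re * (s i).im) = 0 := by
      have := congrArg (QuadraticAlgebra.linearEquivTuple d 0 · 1) h0
      simp only [map_sum, Finset.sum_apply, QuadraticAlgebra.linearEquivTuple_apply] at this
      refine Eq.trans (Finset.sum_congr rfl fun i _ => ?_) (by simpa using this)
      ring
    simp only [T, LinearMap.coe_mk, AddHom.coe_mk, weightedSumSquares_apply, Fintype.sum_sum_type,
      Sum.elim_inl, Sum.elim_inr, smul_eq_mul, ← Finset.sum_add_distrib]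
    calc _ = ∑ i, w i * ((s i).re ^ 2 + d * (s i).im ^ 2) +
        u * ∑ i, w i * (2 * (s i).re * (s i).im) := by
          rw [Finset.mul_sum, ← Finset.sum_add_distrib]
          exact Finset.sum_congr rfl fun i _ => by ring
      _ = 0 := by rw [hre, him, mul_zero, add_zero]
  · rw [← (Submodule.equivMapOfInjective T hT _).finrank_eq]
    have : finrank M (S.restrictScalars M) = finrank M S := rfl
    -- Restricting scalars doubles the dimension of `S`, matching the doubled number of variables.
    rw [this, ← finrank_mul_finrank M (QuadraticAlgebra M d 0) S, QuadraticAlgebra.finrank_eq_two]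
    simp at hd ⊢
    omega

end Weighted

/-! ### Generic zeros of diagonal forms. -/

section GenericZero

variable {F : Type*} [Field F] {ι κ : Type*} [Fintype ι] {M : Type*} [Field M]
  [Algebra F M]

/-- The polynomial `∑ βᵢ Xᵢ²`. -/
def diagonalPolynomial (β : ι → F) : MvPolynomial ι F :=
  ∑ i, MvPolynomial.C (β i) * MvPolynomial.X i ^ 2

/-- `x` is a generic zero of `∑ βᵢ Xᵢ²`: the polynomials vanishing at `x` are its multiples. -/
def IsGenericZero (β : ι → F) (x : ι → M) : Prop :=
  ∀ g : MvPolynomial ι F, MvPolynomial.aeval x g = 0 ↔ diagonalPolynomial β ∣ g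

theorem aeval_diagonalPolynomial (β : ι → F) (x : ι → M) :
    MvPolynomial.aeval x (diagonalPolynomial β) = ∑ i, algebraMap F M (β i) * x i ^ 2 := by
  simp [diagonalPolynomial]

theorem diagonalPolynomial_ne_zero {β : ι → F} {i₀ : ι} (h : β i₀ ≠ 0) :
    diagonalPolynomial β ≠ 0 := by
  classical
  intro h0
  have := congrArg (MvPolynomial.eval (Pi.single i₀ 1)) h0
  rw [diagonalPolynomial, map_sum, Finset.sum_eq_single i₀] at this
  · simp [h] at this
  · intro j _ hj
    simp [hj]
  · simp

theorem IsGenericZero.sum_eq_zero {β : ι → F} {x : ι → M} (h : IsGenericZero β x) :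
    ∑ i, algebraMap F M (β i) * x i ^ 2 = 0 := by
  rw [← aeval_diagonalPolynomial]
  exact (h _).2 dvd_rfl

theorem sum_mul_update_sq [DecidableEq ι] (β x : ι → M) (i₀ : ι) (r : M) :
    ∑ i, β i * Function.update x i₀ r i ^ 2 =
      β i₀ * r ^ 2 + ∑ i ∈ Finset.univ.erase i₀, β i * x i ^ 2 := by
  rw [← Finset.add_sum_erase _ _ (Finset.mem_univ i₀), Function.update_self]
  congr 1
  refine Finset.sum_congr rfl fun i hi => ?_
  rw [Function.update_of_ne (Finset.ne_of_mem_erase hi)]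

/-- A zero all of whose coordinates but one are algebraically independent is generic. -/
theorem isGenericZero_of_algebraicIndependent {β : ι → F} {i₀ : ι} (hβ : β i₀ ≠ 0)
    (hirr : Irreducible (diagonalPolynomial β)) {x : ι → M}
    (hx : ∑ i, algebraMap F M (β i) * x i ^ 2 = 0)
    (hind : AlgebraicIndependent F fun i : {i // i ≠ i₀} => x i) : IsGenericZero β x := by
  classical
  set P := diagonalPolynomial β with hP
  have hPx : MvPolynomial.aeval x P = 0 := by rw [aeval_diagonalPolynomial, hx]
  intro g
  refine ⟨fun hg => ?_, ?_⟩
  swap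
  · rintro ⟨k, rfl⟩
    rw [map_mul, hPx, zero_mul]
  have hprime : (Ideal.span {P}).IsPrime :=
    (Ideal.span_singleton_prime hirr.ne_zero).2 hirr.prime
  let S := MvPolynomial ι F ⧸ Ideal.span {P}
  have : IsDomain S := Ideal.Quotient.isDomain _
  let A := MvPolynomial {i // i ≠ i₀} F
  let ρ : A →ₐ[F] MvPolynomial ι F := MvPolynomial.rename Subtype.val
  let π : MvPolynomial ι F →+* S := Ideal.Quotient.mk _
  let : Algebra A S := (π.comp ρ.toRingHom).toAlgebra
  have halg : ∀ a : A, algebraMap A S a = π (ρ a) := fun _ => rfl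
  have hρC : ∀ a, ρ (MvPolynomial.C a) = MvPolynomial.C a := MvPolynomial.rename_C _
  have hρX : ∀ i, ρ (MvPolynomial.X i) = MvPolynomial.X (i : ι) := MvPolynomial.rename_X _
  have hπP : π P = 0 := Ideal.Quotient.eq_zero_iff_mem.2 (Ideal.mem_span_singleton_self P)
  -- As `β i₀` is a unit, `P = 0` makes `X i₀` a square root of an element of `A`; the other
  -- variables already come from `A`.
  have hint : ∀ f, IsIntegral A (π f) := by
    intro f
    induction f using MvPolynomial.induction_on with
    | C a =>
      have : π (MvPolynomial.C a) = algebraMap A S (MvPolynomial.C a) := by rw [halg, hρC]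
      rw [this]
      exact isIntegral_algebraMap
    | add f g hf hg =>
      rw [map_add]
      exact hf.add hg
    | mul_X f i hf =>
      rw [map_mul]
      refine hf.mul ?_
      by_cases hi : i = i₀
      · subst hi
        refine IsIntegral.of_pow (n := 2) two_pos ?_
        have : π (MvPolynomial.X i) ^ 2 = algebraMap A S (-MvPolynomial.C (β i)⁻¹ *
            ∑ j : {j // j ≠ i}, MvPolynomial.C (β j) * MvPolynomial.X j ^ 2) := by
          rw [halg, ← sub_eq_zero, ← map_pow, ← map_sub, ← zero_mul (π (MvPolynomial.C (β i)⁻¹)),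
            ← hπP, ← map_mul]
          congr 1
          have hsum : ∑ j : {j // j ≠ i}, MvPolynomial.C (σ := ι) (β j) * MvPolynomial.X (j : ι) ^ 2 =
              ∑ j ∈ Finset.univ.erase i, MvPolynomial.C (β j) * MvPolynomial.X j ^ 2 := by
            rw [Finset.sum_subtype (p := fun j => j ≠ i) _ (by simp)]
          have hinv : MvPolynomial.C (σ := ι) (β i) * MvPolynomial.C (β i)⁻¹ = 1 := by
            rw [← map_mul, mul_inv_cancel₀ hβ, map_one]
          rw [hP, diagonalPolynomial, ← Finset.add_sum_erase _ _ (Finset.mem_univ i), ← hsum]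
          simp only [map_mul, map_neg, map_sum, map_pow, hρX, hρC]
          linear_combination (-MvPolynomial.X i ^ 2) * hinv
        rw [this]
        exact isIntegral_algebraMap
      · have : π (MvPolynomial.X i) = algebraMap A S (MvPolynomial.X ⟨i, hi⟩) := by
          rw [halg, hρX]
        rw [this]
        exact isIntegral_algebraMap
  have : Algebra.IsIntegral A S := ⟨fun s => by
    obtain ⟨f, rfl⟩ := Ideal.Quotient.mk_surjective s
    exact hint f⟩
  let φ : S →+* M := Ideal.Quotient.lift (Ideal.span {P}) (MvPolynomial.aeval x).toRingHom (by
    intro f hf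
    obtain ⟨k, rfl⟩ := Ideal.mem_span_singleton.1 hf
    change MvPolynomial.aeval x (P * k) = 0
    rw [map_mul, hPx, zero_mul])
  have hφ : ∀ f, φ (π f) = MvPolynomial.aeval x f := fun f => rfl
  -- In a domain integral over `A`, a nonzero ideal meets `A` nontrivially, while `hind` says that
  -- `ker φ` meets it only in zero.
  have hbot : RingHom.ker φ = ⊥ := by
    refine Ideal.eq_bot_of_comap_eq_bot (R := A) ?_
    rw [eq_bot_iff]
    intro a ha
    have h1 : φ (algebraMap A S a) = 0 := ha
    rw [halg, hφ, MvPolynomial.aeval_rename] at h1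
    exact hind.eq_zero_of_aeval_eq_zero a h1
  have : π g ∈ RingHom.ker φ := by rw [RingHom.mem_ker, hφ, hg]
  rw [hbot, Ideal.mem_bot] at this
  exact Ideal.mem_span_singleton.1 (Ideal.Quotient.eq_zero_iff_mem.1 this)

/-- The coordinates of a generic zero are algebraically independent once one of them is left
out. -/
theorem IsGenericZero.algebraicIndependent {β : ι → F} {x : ι → M} (hx : IsGenericZero β x)
    (e : κ → ι) (he : Function.Injective e) {j₀ : ι} (hj : j₀ ∉ Set.range e) (hβ : β j₀ ≠ 0) :
    AlgebraicIndependent F (x ∘ e) := by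
  classical
  rw [algebraicIndependent_iff]
  intro g hg
  rw [← MvPolynomial.aeval_rename, hx] at hg
  -- A polynomial relation among the chosen coordinates is a multiple of the diagonal polynomial, so
  -- it vanishes at every zero of the form over `Ω`. One such zero has independent variables at the
  -- chosen places: fill the rest with `0` and solve for coordinate `j₀`.
  let Ω := AlgebraicClosure (FractionRing (MvPolynomial κ F))
  let X : κ → Ω := fun k => algebraMap (MvPolynomial κ F) Ω (MvPolynomial.X k)
  have hX : ∀ f : MvPolynomial κ F, MvPolynomial.aeval X f = algebraMap (MvPolynomial κ F) Ω f := by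
    intro f
    have : MvPolynomial.aeval X = IsScalarTower.toAlgHom F (MvPolynomial κ F) Ω :=
      MvPolynomial.algHom_ext fun k => by simp [X]
    rw [this]
    rfl
  let y₀ : ι → Ω := Function.extend e X 0
  have hβ' : algebraMap F Ω (β j₀) ≠ 0 := by simpa using hβ
  obtain ⟨r, hr⟩ := IsAlgClosed.exists_pow_nat_eq (n := 2) (-(algebraMap F Ω (β j₀))⁻¹ *
    ∑ i ∈ Finset.univ.erase j₀, algebraMap F Ω (β i) * y₀ i ^ 2) two_pos
  let y := Function.update y₀ j₀ r
  set b := algebraMap F Ω (β j₀) with hb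
  have hy : MvPolynomial.aeval y (diagonalPolynomial β) = 0 := by
    rw [aeval_diagonalPolynomial, sum_mul_update_sq (fun i => algebraMap F Ω (β i)), hr, ← hb,
      neg_mul, mul_neg,
      mul_inv_cancel_left₀ hβ', neg_add_cancel]
  have hye : y ∘ e = X := by
    ext k
    have : e k ≠ j₀ := fun h => hj ⟨k, h⟩
    simp [y, y₀, this, he.extend_apply]
  obtain ⟨q, hq⟩ := hg
  have h0 := congrArg (MvPolynomial.aeval y) hq
  rw [map_mul, hy, zero_mul, MvPolynomial.aeval_rename, hye, hX] at h0
  rw [IsScalarTower.algebraMap_apply _ (FractionRing (MvPolynomial κ F))] at h0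
  simpa using h0

end GenericZero

/-- This verifies that `r = √(-b s) / b` solves `b r² + s = 0`. -/
theorem mul_div_sq_cancel {k : Type*} [Field k] {b : k} (hb : b ≠ 0) (s : k) :
    b * (-(b * s) / b ^ 2) + s = 0 := by
  field_simp
  ring

/-! ### Generic values as similarity factors, and multiplication by `⟨1, a⟩`. -/

section Doubling

variable {F : Type*} [Field F] {ι κ : Type*} [Fintype ι] [Fintype κ]

/-- If `⟨w⟩` is metabolic over every field with a generic zero of `⟨β⟩`, then values of `⟨β⟩`
at generic points, suitably normalized, are similarity factors of `⟨w⟩`. -/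
theorem hasLagrangian_of_generic_value {β : ι → F} {w : κ → F} {i₀ : ι} (hβ : β i₀ ≠ 0)
    (hirr : Irreducible (diagonalPolynomial β))
    (H : ∀ (M : Type u₁) [Field M] [Algebra F M] (x : ι → M), IsGenericZero β x →
      HasLagrangian (weightedSumSquares M fun i => algebraMap F M (w i)))
    (M : Type u₁) [Field M] [Algebra F M] (x : ι → M) (hx : AlgebraicIndependent F x) :
    HasLagrangian (weightedSumSquares M (Sum.elim (fun i => algebraMap F M (w i))
      fun i => -(algebraMap F M (β i₀) * ∑ i, algebraMap F M (β i) * x i ^ 2) *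
        algebraMap F M (w i))) := by
  classical
  set b := algebraMap F M (β i₀) with hb
  have hb0 : b ≠ 0 := by simpa [hb] using hβ
  set σ := ∑ i ∈ Finset.univ.erase i₀, algebraMap F M (β i) * x i ^ 2 with hσ
  have hsum : ∑ i, algebraMap F M (β i) * x i ^ 2 = b * x i₀ ^ 2 + σ := by
    rw [← Finset.add_sum_erase _ _ (Finset.mem_univ i₀)]
  have hx' : AlgebraicIndependent F fun i : {i // i ≠ i₀} => x i :=
    hx.comp _ Subtype.val_injective
  have hupd : ∀ r, (fun i : {i // i ≠ i₀} => Function.update x i₀ r i) =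
      fun i : {i // i ≠ i₀} => x i := fun r => by
    ext i
    rw [Function.update_of_ne i.2]
  -- If `-bσ` is already a square, the generic zero lives over `M` and `⟨w⟩` itself is metabolic
  -- there; otherwise a quadratic extension is needed.
  by_cases hd : ∃ r, r ^ 2 = -(b * σ)
  · obtain ⟨r, hr⟩ := hd
    have h1 := H M (Function.update x i₀ (r / b)) (isGenericZero_of_algebraicIndependent hβ hirr
      (by
        rw [sum_mul_update_sq (fun i => algebraMap F M (β i)), ← hσ, ← hb, div_pow, hr]
        exact mul_div_sq_cancel hb0 _) (by rwa [hupd]))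
    exact h1.sumElim (h1.smul_weights _)
  · set d := -(b * σ) with hdef
    have : Fact (∀ r : M, r ^ 2 ≠ d + 0 * r) := ⟨fun r hr => hd ⟨r, by simpa using hr⟩⟩
    let N := QuadraticAlgebra M d 0
    let y : ι → N := Function.update (fun i => algebraMap M N (x i)) i₀
      (QuadraticAlgebra.omega / algebraMap M N b)
    have hFN : ∀ a : F, algebraMap F N a = algebraMap M N (algebraMap F M a) := fun a => rfl
    have hy : IsGenericZero β y := by
      refine isGenericZero_of_algebraicIndependent hβ hirr ?_ ?_
      · have hσ' : ∑ i ∈ Finset.univ.erase i₀, algebraMap F N (β i) * (algebraMap M N (x i)) ^ 2 =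
            algebraMap M N σ := by
          simp only [hσ, hFN, map_sum, map_mul, map_pow]
        have hb' : algebraMap M N b ≠ 0 := by simpa using hb0
        have hω : (QuadraticAlgebra.omega : N) ^ 2 = algebraMap M N d := by
          rw [pow_two, QuadraticAlgebra.omega_mul_omega_eq_mk]
          rfl
        have hd' : algebraMap M N d = -(algebraMap M N b * algebraMap M N σ) := by
          rw [← map_mul, ← map_neg]
        rw [sum_mul_update_sq (fun i => algebraMap F N (β i)), hσ', hFN, ← hb, div_pow, hω, hd']
        exact mul_div_sq_cancel hb' _
      · have : (fun i : {i // i ≠ i₀} => y i) = fun i : {i // i ≠ i₀} => algebraMap M N (x i) := by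
          ext1 i
          exact Function.update_of_ne i.2 _ _
        rw [this]
        have : IsScalarTower F M N := IsScalarTower.of_algebraMap_eq hFN
        exact hx'.map' (f := IsScalarTower.toAlgHom F M N) (algebraMap M N).injective
    have h1 := H N y hy
    -- The choice `u = b x₀` gives `u² - d = b (b x₀² + σ)`, which is `b` times the value of `⟨β⟩`
    -- at `x`.
    have h2 := hasLagrangian_of_quadraticAlgebra d (fun i => algebraMap F M (w i)) (b * x i₀) h1
    convert h2 using 5
    rw [hsum, hdef]
    ring

/-- The doubling step: metabolicity over generic zeros passes from `(β, w)` to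
`(⟨1, a⟩ β, ⟨1, a⟩ w)`. -/
theorem hasLagrangian_double [Invertible (2 : F)] {β : ι → F} {w : κ → F} {a : F} {i₀ : ι}
    (hβ : β i₀ ≠ 0) (ha : a ≠ 0)
    (hw : ∀ i, w i ≠ 0) (hirr : Irreducible (diagonalPolynomial β))
    (H : ∀ (M : Type u₁) [Field M] [Algebra F M] (x : ι → M), IsGenericZero β x →
      HasLagrangian (weightedSumSquares M fun i => algebraMap F M (w i)))
    (M : Type u₁) [Field M] [Algebra F M] (x : ι ⊕ ι → M)
    (hx : IsGenericZero (Sum.elim β fun i => a * β i) x) :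
    HasLagrangian (weightedSumSquares M fun i =>
      algebraMap F M (Sum.elim w (fun i => a * w i) i)) := by
  have : Invertible (2 : M) := (Invertible.map (algebraMap F M) 2).copy 2 (map_ofNat _ _).symm
  -- Each half of the coordinates leaves out the other half, hence a coordinate with nonzero
  -- coefficient.
  have hl : AlgebraicIndependent F (x ∘ Sum.inl) :=
    hx.algebraicIndependent Sum.inl Sum.inl_injective (j₀ := Sum.inr i₀) (by simp) (by simp [ha, hβ])
  have hr : AlgebraicIndependent F (x ∘ Sum.inr) :=
    hx.algebraicIndependent Sum.inr Sum.inr_injective (j₀ := Sum.inl i₀) (by simp) (by simpa)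
  have h1 := hasLagrangian_of_generic_value hβ hirr H M _ hl
  have h2 := hasLagrangian_of_generic_value hβ hirr H M _ hr
  have h0 := hx.sum_eq_zero
  rw [Fintype.sum_sum_type] at h0
  simp only [Sum.elim_inl, Sum.elim_inr, map_mul, mul_assoc, ← Finset.mul_sum] at h0
  have hne : ∑ i, algebraMap F M (β i) * x (Sum.inr i) ^ 2 ≠ 0 := by
    intro h
    refine diagonalPolynomial_ne_zero hβ (hr.eq_zero_of_aeval_eq_zero _ ?_)
    rw [aeval_diagonalPolynomial]
    exact h
  have key := hasLagrangian_of_similarity (w := fun i => algebraMap F M (w i))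
    (a := algebraMap F M a) (by simpa using hw) (by simpa using ha)
    (mul_ne_zero (by simpa using hβ) hne) ?_ h1 h2
  · convert key using 2
    ext (i | i) <;> simp
  · simp only [Function.comp_apply]
    linear_combination (algebraMap F M (β i₀)) * h0

end Doubling

/-! ### Independence of the form polynomial from the coordinates. -/

section Coordinates

section

variable {F : Type*} [Field F] {V : Type*} [AddCommGroup V] [Module F V]
  {ι κ : Type*} [Fintype ι] [Fintype κ]

/-- The substitution expressing the coordinates with respect to `b` by those with respect to
`b'`. -/
def coordinateChange (b : Basis ι F V) (b' : Basis κ F V) :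
    MvPolynomial ι F →ₐ[F] MvPolynomial κ F :=
  MvPolynomial.aeval fun i => ∑ j, MvPolynomial.C (b.repr (b' j) i) * MvPolynomial.X j

theorem coordinateChange_comp (b : Basis ι F V) (b' : Basis κ F V) (g : MvPolynomial ι F) :
    coordinateChange b' b (coordinateChange b b' g) = g := by
  classical
  suffices h : (coordinateChange b' b).comp (coordinateChange b b') = AlgHom.id F _ from
    DFunLike.congr_fun h g
  refine MvPolynomial.algHom_ext fun i => ?_
  simp only [coordinateChange, AlgHom.comp_apply, MvPolynomial.aeval_X, map_sum, map_mul,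
    MvPolynomial.algHom_C, MvPolynomial.algebraMap_eq, Finset.mul_sum, AlgHom.id_apply]
  rw [Finset.sum_comm]
  have : ∀ k, ∑ j, b.repr (b' j) i * b'.repr (b k) j = if k = i then 1 else 0 := by
    intro k
    have h := congrArg (fun v => b.repr v i) (b'.sum_repr (b k))
    simp only [map_sum, map_smul, Finsupp.coe_finsetSum, Finset.sum_apply, Finsupp.smul_apply,
      smul_eq_mul, Basis.repr_self, Finsupp.single_apply] at h
    rw [← h]
    exact Finset.sum_congr rfl fun j _ => mul_comm _ _
  simp only [← mul_assoc, ← map_mul, ← Finset.sum_mul, ← map_sum, this]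
  simp

end

variable {F : Type*} [Field F] [Invertible (2 : F)] {V V' : Type*} [AddCommGroup V] [Module F V]
  [AddCommGroup V'] [Module F V'] {ι κ : Type*} [Fintype ι] [Fintype κ]

theorem coordinateChange_formPolynomial (p : QuadraticForm F V) (b : Basis ι F V)
    (b' : Basis κ F V) : coordinateChange b b' (formPolynomial p b) = formPolynomial p b' := by
  have hB : ∀ j k, associated p (b' j) (b' k) =
      ∑ i, ∑ l, associated p (b i) (b l) * (b.repr (b' j) i * b.repr (b' k) l) := by
    intro j k
    conv_lhs => rw [← b.sum_repr (b' j), ← b.sum_repr (b' k)]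
    simp only [map_sum, LinearMap.sum_apply, map_smul, LinearMap.smul_apply, smul_eq_mul,
      Finset.mul_sum]
    rw [Finset.sum_comm]
    exact Finset.sum_congr rfl fun i _ => Finset.sum_congr rfl fun l _ => by ring
  simp only [formPolynomial, coordinateChange, map_sum, map_mul, MvPolynomial.algHom_C,
    MvPolynomial.algebraMap_eq, MvPolynomial.aeval_X, hB, Finset.mul_sum,
    Finset.sum_mul]
  simp only [← Fintype.sum_prod_type']
  let e : ι × ι × κ × κ ≃ κ × κ × ι × ι :=
    { toFun := fun x => (x.2.2.2, x.2.2.1, x.1, x.2.1)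
      invFun := fun y => (y.2.2.1, y.2.2.2, y.2.1, y.1)
      left_inv := fun _ => rfl
      right_inv := fun _ => rfl }
  rw [← Equiv.sum_comp e]
  refine Finset.sum_congr rfl fun x _ => ?_
  simp only [e, Equiv.coe_fn_mk]
  ring

theorem formPolynomial_map (p : QuadraticForm F V) (p' : QuadraticForm F V')
    (e : p.IsometryEquiv p') (b : Basis ι F V) :
    formPolynomial p' (b.map e.toLinearEquiv) = formPolynomial p b := by
  have : ∀ x, p' (e.toLinearEquiv x) = p x := e.map_app
  simp only [formPolynomial, Basis.map_apply, associated_apply, ← map_add, this]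

theorem formPolynomial_weightedSumSquares (β : ι → F) :
    formPolynomial (weightedSumSquares F β) (Pi.basisFun F ι) = diagonalPolynomial β := by
  classical
  simp only [formPolynomial, associated_weightedSumSquares_basisFun, diagonalPolynomial]
  refine Finset.sum_congr rfl fun i _ => ?_
  rw [Finset.sum_eq_single i]
  · simp [pow_two]
  · intro j _ hj
    simp [hj.symm]
  · simp

/-- This links the arbitrary basis allowed in `IsFunctionField` to a diagonalization: the isometry
and the change of basis are invertible linear substitutions. -/
theorem exists_algEquiv_formPolynomial {p : QuadraticForm F V} {β : ι → F}
    (h : p.Equivalent (weightedSumSquares F β)) (b : Basis κ F V) :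
    ∃ τ : MvPolynomial κ F ≃ₐ[F] MvPolynomial ι F,
      τ (formPolynomial p b) = diagonalPolynomial β := by
  obtain ⟨e⟩ := h
  let b' := b.map e.toLinearEquiv
  let c := Pi.basisFun F ι
  refine ⟨AlgEquiv.ofAlgHom (coordinateChange b' c) (coordinateChange c b')
    (AlgHom.ext fun g => coordinateChange_comp c b' g)
    (AlgHom.ext fun g => coordinateChange_comp b' c g), ?_⟩
  rw [← formPolynomial_map p _ e, ← formPolynomial_weightedSumSquares]
  exact coordinateChange_formPolynomial _ b' c

theorem irreducible_diagonalPolynomial [Nonempty ι] {β : ι → F} (hβ : ∀ i, β i ≠ 0)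
    (h : ¬ HasTrivialFunctionField (weightedSumSquares F β)) :
    Irreducible (diagonalPolynomial β) := by
  rw [← formPolynomial_weightedSumSquares]
  exact irreducible_formPolynomial _ (nondegenerate_weightedSumSquares hβ) h _

end Coordinates

/-! ### Function fields and generic zeros. -/

section FunctionField

variable {F : Type*} [Field F] [Invertible (2 : F)] {V : Type*} [AddCommGroup V] [Module F V]
  {ι : Type*} [Fintype ι] {p : QuadraticForm F V} {β : ι → F}
  {K : Type*} [Field K] [Algebra F K]

/-- The function field of a form contains a generic zero of the form. -/
theorem IsFunctionField.exists_isGenericZero (hK : IsFunctionField p K)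
    (hp : ¬ HasTrivialFunctionField p) (h : p.Equivalent (weightedSumSquares F β)) :
    ∃ x : ι → K, IsGenericZero β x := by
  obtain ⟨b, ⟨e⟩⟩ := (hK.resolve_left fun h => hp h.1).2
  obtain ⟨τ, hτ⟩ := exists_algEquiv_formPolynomial h b
  set P := formPolynomial p b
  set S := MvPolynomial (Fin (finrank F V)) F ⧸ Ideal.span {P}
  let ψ : MvPolynomial ι F →ₐ[F] K := e.symm.toAlgHom.comp
    ((IsScalarTower.toAlgHom F S (FractionRing S)).comp ((Ideal.Quotient.mkₐ F _).comp τ.symm))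
  have hψ : ∀ g, ψ g = 0 ↔ diagonalPolynomial β ∣ g := by
    intro g
    have h1 : ψ g = e.symm (algebraMap S (FractionRing S) (Ideal.Quotient.mk _ (τ.symm g))) := rfl
    rw [h1, map_eq_zero_iff _ e.symm.injective,
      map_eq_zero_iff _ (IsFractionRing.injective S (FractionRing S)),
      Ideal.Quotient.eq_zero_iff_mem, Ideal.mem_span_singleton, ← hτ]
    rw [← map_dvd_iff τ, AlgEquiv.apply_symm_apply]
  -- The generic zero consists of the images of the variables.
  refine ⟨fun i => ψ (MvPolynomial.X i), fun g => ?_⟩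
  rw [← hψ]
  have : MvPolynomial.aeval (fun i => ψ (MvPolynomial.X i)) = ψ :=
    MvPolynomial.algHom_ext fun i => by simp
  rw [this]

/-- The function field of a form embeds into every field with a generic zero of the form. -/
theorem IsFunctionField.nonempty_algHom (hK : IsFunctionField p K)
    (hp : ¬ HasTrivialFunctionField p) (h : p.Equivalent (weightedSumSquares F β))
    {M : Type*} [Field M] [Algebra F M] {x : ι → M} (hx : IsGenericZero β x) :
    Nonempty (K →ₐ[F] M) := by
  obtain ⟨b, ⟨e⟩⟩ := (hK.resolve_left fun h => hp h.1).2
  obtain ⟨τ, hτ⟩ := exists_algEquiv_formPolynomial h b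
  set P := formPolynomial p b
  set S := MvPolynomial (Fin (finrank F V)) F ⧸ Ideal.span {P}
  let θ : MvPolynomial (Fin (finrank F V)) F →ₐ[F] M := (MvPolynomial.aeval x).comp τ
  have hθ : ∀ g, θ g = 0 ↔ g ∈ Ideal.span {P} := by
    intro g
    rw [Ideal.mem_span_singleton, ← map_dvd_iff τ, hτ]
    exact hx (τ g)
  let φ : S →ₐ[F] M := Ideal.Quotient.liftₐ _ θ fun g hg => (hθ g).2 hg
  have hφ : Function.Injective φ := by
    rw [injective_iff_map_eq_zero]
    intro s hs
    obtain ⟨g, rfl⟩ := Ideal.Quotient.mk_surjective s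
    exact Ideal.Quotient.eq_zero_iff_mem.2 ((hθ g).1 hs)
  -- `S` embeds into the field `M`, so its being a domain needs no irreducibility argument.
  have : IsDomain S := hφ.isDomain φ.toRingHom
  exact ⟨(IsFractionRing.liftAlgHom (K := FractionRing S) hφ).comp e.toAlgHom⟩

end FunctionField

/-! ### Induction over the binary factors of a Pfister form. -/

section Induction

variable {F : Type*} [Field F]

theorem HasTrivialFunctionField.of_equivalent {V V' : Type*} [AddCommGroup V] [Module F V]
    [AddCommGroup V'] [Module F V'] {p : QuadraticForm F V} {p' : QuadraticForm F V'}
    (h : HasTrivialFunctionField p) (e : p.Equivalent p') : HasTrivialFunctionField p' := by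
  refine h.imp (fun h1 => ?_) e.symm.trans
  obtain ⟨e⟩ := e
  rw [← e.toLinearEquiv.finrank_eq, h1]

theorem IsHyperbolic.of_equivalent {V V' : Type*} [AddCommGroup V] [Module F V]
    [AddCommGroup V'] [Module F V'] {p : QuadraticForm F V} {p' : QuadraticForm F V'}
    (h : IsHyperbolic p) (e : p.Equivalent p') : IsHyperbolic p' := by
  obtain ⟨m, h⟩ := h
  exact ⟨m, e.symm.trans h⟩

theorem not_hasTrivialFunctionField_of_three_le {ι : Type*} [Fintype ι] (β : ι → F)
    (h : 3 ≤ Fintype.card ι) : ¬ HasTrivialFunctionField (weightedSumSquares F β) := by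
  rintro (h1 | ⟨⟨e⟩⟩)
  · rw [finrank_fintype_fun_eq_card] at h1
    omega
  · have := e.toLinearEquiv.finrank_eq
    simp only [finrank_fintype_fun_eq_card, Fintype.card_fin] at this
    omega

theorem HasLagrangian.map_weights [Invertible (2 : F)] {κ : Type*} [Fintype κ] {w : κ → F}
    {K : Type*} [Field K] [Algebra F K] {M : Type*} [Field M] [Algebra F M] (f : K →ₐ[F] M)
    (h : HasLagrangian (weightedSumSquares K fun i => algebraMap F K (w i))) :
    HasLagrangian (weightedSumSquares M fun i => algebraMap F M (w i)) := by
  have : Invertible (2 : K) := (Invertible.map (algebraMap F K) 2).copy 2 (map_ofNat _ _).symm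
  let : Algebra K M := f.toRingHom.toAlgebra
  have h1 := (h.baseChange M).of_equivalent (baseChange_weightedSumSquares _ M)
  have : ∀ i, algebraMap K M (algebraMap F K (w i)) = algebraMap F M (w i) := fun i =>
    f.commutes (w i)
  simpa only [this] using h1

variable [Invertible (2 : F)]

theorem exists_equivalent_weightedSumSquares {V : Type*} [AddCommGroup V] [Module F V]
    [FiniteDimensional F V] (q : QuadraticForm F V) (hq : q.Nondegenerate) :
    ∃ w : Fin (finrank F V) → F, (∀ i, w i ≠ 0) ∧ q.Equivalent (weightedSumSquares F w) := by
  obtain ⟨w, h⟩ := QuadraticForm.equivalent_weightedSumSquares_units_of_nondegenerate' q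
    (nondegenerate_associated hq).1
  exact ⟨fun i => w i, fun i => (w i).ne_zero, h⟩

theorem tmul_pfisterModule_cons {V : Type*} [AddCommGroup V] [Module F V]
    (p : QuadraticForm F V) (a : Fˣ) (l : List Fˣ) {ι : Type*} [Fintype ι] {β : ι → F}
    (h : (QuadraticForm.tmul (pfisterModule l).form p).Equivalent (weightedSumSquares F β)) :
    (QuadraticForm.tmul (pfisterModule (a :: l)).form p).Equivalent
      (weightedSumSquares F (Sum.elim β fun i => (a : F) * β i)) := by
  refine Equivalent.trans ?_ ((equivalent_tmul (Equivalent.refl (binaryForm (a : F))) h).trans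
    (tmul_binaryForm (a : F) β))
  exact ⟨QuadraticForm.tensorAssoc (binaryForm (a : F)) (pfisterModule l).form p⟩

/-- A property of pairs of diagonal forms that is stable under multiplication by binary forms
`⟨1, a⟩` is stable under multiplication by Pfister forms. -/
theorem exists_diagonal_pfister_multiple {V W : Type*} [AddCommGroup V] [Module F V]
    [AddCommGroup W] [Module F W] {p : QuadraticForm F V} {q : QuadraticForm F W}
    (Φ : ∀ (ι κ : Type) [Fintype ι] [Fintype κ], (ι → F) → (κ → F) → Prop)
    (hΦ : ∀ (ι κ : Type) [Fintype ι] [Fintype κ] (β : ι → F) (w : κ → F) (a : F), a ≠ 0 →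
      Φ ι κ β w → Φ (ι ⊕ ι) (κ ⊕ κ) (Sum.elim β fun i => a * β i) (Sum.elim w fun i => a * w i))
    {ι κ : Type} [Fintype ι] [Fintype κ] {β : ι → F} {w : κ → F}
    (hp : p.Equivalent (weightedSumSquares F β)) (hq : q.Equivalent (weightedSumSquares F w))
    (h : Φ ι κ β w) (l : List Fˣ) :
    ∃ (ι' κ' : Type) (_ : Fintype ι') (_ : Fintype κ') (β' : ι' → F) (w' : κ' → F),
      Φ ι' κ' β' w' ∧
      (QuadraticForm.tmul (pfisterModule l).form p).Equivalent (weightedSumSquares F β') ∧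
      (QuadraticForm.tmul (pfisterModule l).form q).Equivalent (weightedSumSquares F w') := by
  induction l with
  | nil =>
    exact ⟨ι, κ, inferInstance, inferInstance, β, w, h,
      Equivalent.trans ⟨QuadraticForm.tensorLId p⟩ hp,
      Equivalent.trans ⟨QuadraticForm.tensorLId q⟩ hq⟩
  | cons a l ih =>
    obtain ⟨ι', κ', _, _, β', w', h1, h2, h3⟩ := ih
    exact ⟨_, _, inferInstance, inferInstance, _, _, hΦ ι' κ' β' w' a a.ne_zero h1,
      tmul_pfisterModule_cons p a l h2, tmul_pfisterModule_cons q a l h3⟩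

theorem isHyperbolic_baseChange_of_hasLagrangian {V : Type*} [AddCommGroup V] [Module F V]
    {q : QuadraticForm F V} {κ : Type*} [Fintype κ] {w : κ → F} (hw : ∀ i, w i ≠ 0)
    (hq : q.Equivalent (weightedSumSquares F w)) {L : Type*} [Field L] [Algebra F L]
    (h : HasLagrangian (weightedSumSquares L fun i => algebraMap F L (w i))) :
    IsHyperbolic (QuadraticForm.baseChange L q) := by
  have : Invertible (2 : L) := (Invertible.map (algebraMap F L) 2).copy 2 (map_ofNat _ _).symm
  refine IsHyperbolic.of_equivalent (isHyperbolic_of_hasLagrangian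
    (nondegenerate_weightedSumSquares ?_) h)
    ((equivalent_baseChange hq L).trans (baseChange_weightedSumSquares w L)).symm
  simpa using hw

end Induction

end PfisterMultiples

open PfisterMultiples in
theorem corollaryF32 {F : Type*} [Field F] [Invertible (2 : F)]
    {V W U : Type*} [AddCommGroup V] [Module F V] [FiniteDimensional F V] [Nontrivial V]
    [AddCommGroup W] [Module F W] [FiniteDimensional F W] [Nontrivial W]
    [AddCommGroup U] [Module F U] [FiniteDimensional F U] [Nontrivial U]
    (p : QuadraticForm F V) (hp : p.Nondegenerate)
    (q : QuadraticForm F W) (hq : q.Nondegenerate)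
    (n : ℕ) (π : QuadraticForm F U) (hπ : PfisterMultiples.IsPfister n π)
    {K : Type*} [Field K] [Algebra F K] (hK : PfisterMultiples.IsFunctionField p K)
    {L : Type*} [Field L] [Algebra F L]
    (hL : PfisterMultiples.IsFunctionField (QuadraticForm.tmul π p) L)
    (hyp : PfisterMultiples.IsHyperbolic (QuadraticForm.baseChange K q)) :
    PfisterMultiples.IsHyperbolic (QuadraticForm.baseChange L (QuadraticForm.tmul π q)) := by
  obtain ⟨a, hπ⟩ := hπ
  obtain ⟨β, hβ, hpβ⟩ := exists_equivalent_weightedSumSquares p hp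
  obtain ⟨w, hw, hqw⟩ := exists_equivalent_weightedSumSquares q hq
  have hwK : HasLagrangian (QuadraticMap.weightedSumSquares K fun i => algebraMap F K (w i)) :=
    hyp.hasLagrangian.of_equivalent
      ((equivalent_baseChange hqw K).trans (baseChange_weightedSumSquares w K))
  have hne : ∀ {κ : Type} (w : κ → F) (a : F), a ≠ 0 → (∀ i, w i ≠ 0) →
      ∀ i, Sum.elim w (fun i => a * w i) i ≠ 0 := by
    rintro κ w a ha hw (i | i) <;> simp [ha, hw]
  have hπq := equivalent_tmul hπ (QuadraticMap.Equivalent.refl q)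
  have hπp := equivalent_tmul hπ (QuadraticMap.Equivalent.refl p)
  by_cases htriv : HasTrivialFunctionField p
  -- Here `K` is `F`, so `⟨w⟩` is metabolic over every extension of `F`, in particular over `L`, and
  -- so are its multiples; no generic zero is involved.
  · obtain ⟨e⟩ := (hK.resolve_right fun h => h.1 htriv).2
    obtain ⟨ι', κ', _, _, β', w', ⟨hw', h'⟩, -, hq'⟩ := exists_diagonal_pfister_multiple
      (Φ := fun ι κ _ _ β w => (∀ i, w i ≠ 0) ∧
        HasLagrangian (QuadraticMap.weightedSumSquares L fun i => algebraMap F L (w i)))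
      (fun ι κ _ _ β w a ha ⟨h1, h2⟩ => ⟨hne w a ha h1, by
        convert h2.sumElim (h2.smul_weights (algebraMap F L a)) using 2
        ext (i | i) <;> simp⟩)
      hpβ hqw ⟨hw, hwK.map_weights ((Algebra.ofId F L).comp e.toAlgHom)⟩ (List.ofFn a)
    exact isHyperbolic_baseChange_of_hasLagrangian hw' (hπq.trans hq') h'
  · have : Nonempty (Fin (Module.finrank F V)) := ⟨⟨0, Module.finrank_pos⟩⟩
    obtain ⟨ι', κ', _, _, β', w', ⟨hβ', hw', h0, h1, h2⟩, hp', hq'⟩ :=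
      exists_diagonal_pfister_multiple
        -- The property ranges over all fields `M` with a generic zero because the doubling step
        -- applies it to quadratic extensions of a given `M`.
        (Φ := fun ι κ _ _ β w => (∀ i, β i ≠ 0) ∧ (∀ i, w i ≠ 0) ∧ Nonempty ι ∧
          ¬ HasTrivialFunctionField (QuadraticMap.weightedSumSquares F β) ∧
          ∀ (M : Type _) [Field M] [Algebra F M] (x : ι → M), IsGenericZero β x →
            HasLagrangian (QuadraticMap.weightedSumSquares M fun i => algebraMap F M (w i)))
        (fun ι κ _ _ β w a ha ⟨h1, h2, h3, h4, h5⟩ =>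
          ⟨hne β a ha h1, hne w a ha h2, inferInstance, by
            refine not_hasTrivialFunctionField_of_three_le _ ?_
            -- A nontrivial function field forces dimension at least two, so the doubled form has
            -- dimension at least four and cannot be a hyperbolic plane.
            have c1 : Fintype.card ι ≠ 1 := fun h => h4 (Or.inl (by simpa using h))
            have c0 : 0 < Fintype.card ι := Fintype.card_pos
            rw [Fintype.card_sum]
            omega, fun M _ _ x hx => hasLagrangian_double (h1 h3.some) ha h2
              (irreducible_diagonalPolynomial h1 h4) h5 M x hx⟩)
        hpβ hqw ⟨hβ, hw, this, fun h => htriv (h.of_equivalent hpβ.symm), fun M _ _ x hx => by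
          obtain ⟨f⟩ := hK.nonempty_algHom htriv hpβ hx
          exact hwK.map_weights f⟩ (List.ofFn a)
    obtain ⟨x, hx⟩ := hL.exists_isGenericZero
      (fun h => h1 (h.of_equivalent (hπp.trans hp'))) (hπp.trans hp')
    exact isHyperbolic_baseChange_of_hasLagrangian hw' (hπq.trans hq') (h2 L x hx)

end
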